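/- Let $F$ and $G$ be finite simple graphs. For $n \ge 0$, the $F$-multicolor Turán number $ex_F(n,G)$ is the maximum number of pairwise edge-disjoint copies of $F$ (not necessarily induced) on an $n$-element vertex set such that there is no copy of $G$ whose edges come from distinct copies of $F$ in the collection. For a positive integer $t$, let $C_k(t)$ be the $t$-blow-up of the cycle $C_k$: each vertex is replaced by an independent set of $t$ vertices and each edge by a complete bipartite graph between the corresponding sets. **Theorem.** Let $k \ge 5$ be an odd integer, let $\ell = k-2$, and let $t$ be a positive integer. Then $$ex_{C_k(t)}(n, C_\ell) = \frac{n^2}{(kt)^2} + o(n^2) \qquad (n \to \infty),$$ where $k$ and $t$ are fixed. (Here $kt$ is the number of vertices of $C_k(t)$.) -/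

import Mathlib

open Filter Asymptotics

namespace SimpleGraph

/-- The `t`-blow-up `F(t)` of a graph `F`: every vertex `v` is replaced by `t` pairwise
nonadjacent vertices `(v, i)`, and every edge by a complete bipartite graph. -/
def blowUp {V : Type*} (F : SimpleGraph V) (t : ℕ) : SimpleGraph (V × Fin t) :=
  F.comap Prod.fst

/-- `P` is a collection of pairwise edge-disjoint (not necessarily induced) copies of `F` on the
vertex set `X`, each copy being a subgraph of the complete graph on `X`. -/
def IsEdgeDisjointCopies {V X : Type*} (F : SimpleGraph V)
    (P : Finset (⊤ : SimpleGraph X).Subgraph) : Prop :=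
  (∀ A ∈ P, Nonempty (F ≃g A.coe)) ∧
    ∀ A ∈ P, ∀ B ∈ P, A ≠ B → Disjoint A.edgeSet B.edgeSet

/-- There is a copy of `G` on the vertex set `X` (given by an injection `f` of the vertices) whose
edges come from distinct members of `P`: the edge `e` of `G` is mapped to an edge of the member
`c e` of `P`, and different edges get different members. -/
def HasRainbowCopy {W X : Type*} (G : SimpleGraph W)
    (P : Finset (⊤ : SimpleGraph X).Subgraph) : Prop :=
  ∃ (f : W ↪ X) (c : G.edgeSet → (⊤ : SimpleGraph X).Subgraph),
    Function.Injective c ∧ ∀ e : G.edgeSet, c e ∈ P ∧ (e : Sym2 W).map f ∈ (c e).edgeSet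

/-- The sizes of the collections of edge-disjoint copies of `F` on an `n`-element vertex set with
no rainbow copy of `G`. -/
def multicolorSizes {V W : Type*} (F : SimpleGraph V) (G : SimpleGraph W) (n : ℕ) : Set ℕ :=
  {m | ∃ P : Finset (⊤ : SimpleGraph (Fin n)).Subgraph,
    IsEdgeDisjointCopies F P ∧ ¬ HasRainbowCopy G P ∧ P.card = m}

/-- The `F`-multicolor Turán number `ex_F(n, G)`: the maximum number of edge-disjoint copies of
`F` on an `n`-element vertex set with no copy of `G` whose edges come from distinct copies
of `F`. -/
noncomputable def multicolorTuranNumber {V W : Type*} (F : SimpleGraph V) (G : SimpleGraph W)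
    (n : ℕ) : ℕ :=
  sSup (multicolorSizes F G n)

/-- If `G` has an edge, the supremum defining `ex_F(n, G)` is an attained maximum. -/
theorem isGreatest_multicolorTuranNumber {V W : Type*} (F : SimpleGraph V) (G : SimpleGraph W)
    (hG : G.edgeSet.Nonempty) (n : ℕ) :
    IsGreatest (multicolorSizes F G n) (multicolorTuranNumber F G n) := by
  classical
  have hne : (multicolorSizes F G n).Nonempty := by
    refine ⟨0, ∅, ⟨by simp, by simp⟩, ?_, by simp⟩
    rintro ⟨f, c, -, h⟩
    obtain ⟨e, he⟩ := hG
    simpa using (h ⟨e, he⟩).1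
  have hbd : BddAbove (multicolorSizes F G n) := by
    refine ⟨Nat.card (⊤ : SimpleGraph (Fin n)).Subgraph, ?_⟩
    rintro m ⟨P, -, -, rfl⟩
    have := Fintype.ofFinite (⊤ : SimpleGraph (Fin n)).Subgraph
    rw [Nat.card_eq_fintype_card]
    exact P.card_le_univ
  exact ⟨Nat.sSup_mem hne hbd, fun m hm => le_csSup hbd hm⟩

end SimpleGraph

/-! Write k = m + 5 and ℓ = m + 3 with m even.

Lower bound: with q = ⌊n/(kt)⌋, take k disjoint classes, each consisting of q blocks of size t. For
(a, b) in (ℤ/q)² use the blocks a, b, a, b, ..., a, b, a + b around the cycle. Any two consecutive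
blocks determine (a, b), so the q² copies are edge-disjoint. Their union maps to C_k, which receives
no homomorphism from the shorter odd cycle C_ℓ (`sq_mem_multicolorSizes`).

Upper bound: without a rainbow C_ℓ the union of the copies receives only O(n^(ℓ-1)) homomorphisms
from C_ℓ (`card_hom_le_of_not_hasRainbowCopy`). By regularity and cycle counting, deleting at most
εn² edges destroys them all; by edge-disjointness this damages at most εn² copies. Let Q be the set
of undamaged copies and a(v) the number of them through v. In their union every vertex has at most
2t neighbours in each copy, whereas v has degree at least 2t·a(v). Double counting gives ∑ a(v)² ≤
n|Q|; since ∑ a(v) = kt|Q|, Cauchy–Schwarz yields (kt)²|Q| ≤ n² (`sq_mul_card_le_of_isEmpty_hom`).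
-/

namespace SimpleGraph

/-! ### Closed walks and homomorphisms from odd cycles -/

/-- A cyclic sequence of successively adjacent vertices is a homomorphism from a cycle. -/
lemma adj_of_cycleGraph_adj {m : ℕ} {V : Type*} {H : SimpleGraph V} (x : Fin (m + 2) → V)
    (h : ∀ i : Fin (m + 1), H.Adj (x i.castSucc) (x i.succ))
    (hl : H.Adj (x (Fin.last _)) (x 0)) (u v : Fin (m + 2))
    (huv : (cycleGraph (m + 2)).Adj u v) : H.Adj (x u) (x v) := by
  have key : ∀ w : Fin (m + 2), H.Adj (x w) (x (w + 1)) := by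
    intro w
    induction w using Fin.lastCases with
    | last => simpa using hl
    | cast i => simpa using h i
  rw [cycleGraph_adj] at huv
  rcases huv with huv | huv
  · rw [sub_eq_iff_eq_add] at huv
    rw [huv, add_comm]
    exact (key v).symm
  · rw [sub_eq_iff_eq_add] at huv
    rw [huv, add_comm]
    exact key u

lemma adj_succ_of_cycleGraph_hom {m : ℕ} {V : Type*} {H : SimpleGraph V} {x : Fin (m + 2) → V}
    (h : ∀ u v, (cycleGraph (m + 2)).Adj u v → H.Adj (x u) (x v)) (i : Fin (m + 2)) :
    H.Adj (x i) (x (i + 1)) :=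
  h _ _ (by rw [cycleGraph_adj]; right; simp)

lemma Walk.nonempty_cycleGraph_hom {m : ℕ} {V : Type*} {H : SimpleGraph V} {v : V}
    (w : H.Walk v v) (hw : w.length = m + 2) : Nonempty (cycleGraph (m + 2) →g H) := by
  refine ⟨⟨fun i => w.getVert i, fun {a b} hab => ?_⟩⟩
  refine adj_of_cycleGraph_adj (fun i => w.getVert i) (fun i => ?_) ?_ a b hab
  · simpa using w.adj_getVert_succ (i := i) (by omega)
  · have := w.adj_getVert_succ (i := m + 1) (by omega)
    have h2 : w.getVert (m + 1 + 1) = v := by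
      rw [← hw, w.getVert_length]
    rw [h2] at this
    simpa using this

/-- A nontrivial closed walk can be prolonged by any even amount. -/
lemma Walk.exists_closed_length_add {V : Type*} {H : SimpleGraph V} {v : V}
    (w : H.Walk v v) (hw : 0 < w.length) (j : ℕ) :
    ∃ w' : H.Walk v v, w'.length = w.length + 2 * j := by
  obtain ⟨u, hu⟩ : ∃ u, H.Adj v u := by
    cases w with
    | nil => simp at hw
    | cons h p => exact ⟨_, h⟩
  induction j with
  | zero => exact ⟨w, by simp⟩
  | succ j ih =>
    obtain ⟨w', hw'⟩ := ih
    exact ⟨.cons hu (.cons hu.symm w'), by simp [hw']; ring⟩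

/-- There is no homomorphism from an odd cycle to a longer cycle. -/
lemma isEmpty_cycleGraph_hom_cycleGraph {a b : ℕ} (ha : Odd (a + 2)) (hab : a < b) :
    IsEmpty (cycleGraph (a + 2) →g cycleGraph (b + 2)) := by
  refine ⟨fun f => ?_⟩
  -- Winding number: the ±1 increments sum to a multiple of b + 2 of absolute value at most a + 2,
  -- hence to 0, but there is an odd number of them.
  let g : Fin (a + 2) → ZMod (b + 2) := f
  have hstep : ∀ i, ∃ e : ℤ, (e = 1 ∨ e = -1) ∧ g (i + 1) - g i = (e : ZMod (b + 2)) := by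
    intro i
    have := adj_succ_of_cycleGraph_hom (H := cycleGraph (b + 2)) (x := f)
      (fun u v h => f.map_adj h) i
    rw [cycleGraph_adj] at this
    rcases this with h | h
    · refine ⟨-1, Or.inr rfl, ?_⟩
      have h' : g i - g (i + 1) = 1 := h
      rw [← neg_sub, h']; simp
    · refine ⟨1, Or.inl rfl, ?_⟩
      have h' : g (i + 1) - g i = 1 := h
      rw [h']; simp
  choose e he1 he2 using hstep
  have hsum : ((∑ i, e i : ℤ) : ZMod (b + 2)) = 0 := by
    push_cast
    simp_rw [← he2, Finset.sum_sub_distrib]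
    exact sub_eq_zero.2 (Equiv.sum_comp (Equiv.addRight (1 : Fin (a + 2))) g)
  rw [ZMod.intCast_zmod_eq_zero_iff_dvd] at hsum
  have habs : |∑ i, e i| ≤ a + 2 := by
    refine (Finset.abs_sum_le_sum_abs _ _).trans ?_
    have : ∀ i, |e i| = 1 := fun i => by rcases he1 i with h | h <;> simp [h]
    simp [this]
  have hzero : ∑ i, e i = 0 :=
    Int.eq_zero_of_abs_lt_dvd hsum (by push_cast; omega)
  have heven : Even (∑ i, (e i + 1)) :=
    Finset.even_sum _ fun i _ => by rcases he1 i with h | h <;> simp [h]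
  rw [Finset.sum_add_distrib, hzero] at heven
  have heven' : Even (a + 2) := by simpa [parity_simps] using heven
  exact (Nat.not_even_iff_odd.2 ha) heven'

/-! ### Walks in and around a blow-up of an odd cycle -/

open Fin.NatCast in
lemma blowUp_exists_walk {m t : ℕ} (d : ℕ) (i : Fin (m + 2)) (a b : Fin t) :
    ∃ w : (blowUp (cycleGraph (m + 2)) t).Walk (i, a) (i + ((d + 1 : ℕ) : Fin (m + 2)), b),
      w.length = d + 1 := by
  induction d generalizing i a with
  | zero =>
    have h : (blowUp (cycleGraph (m + 2)) t).Adj (i, a) (i + ((0 + 1 : ℕ) : Fin (m + 2)), b) := by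
      simp [blowUp, cycleGraph_adj]
    exact ⟨Walk.cons h .nil, rfl⟩
  | succ d ih =>
    obtain ⟨w, hw⟩ := ih (i + 1) a
    have h : (blowUp (cycleGraph (m + 2)) t).Adj (i, a) (i + 1, a) := by
      simp [blowUp, cycleGraph_adj]
    have he : ((i + 1 + ((d + 1 : ℕ) : Fin (m + 2)), b) : Fin (m + 2) × Fin t) =
        (i + ((d + 1 + 1 : ℕ) : Fin (m + 2)), b) := by
      rw [add_assoc, Nat.cast_succ (d + 1), add_comm (1 : Fin (m + 2))]
    refine ⟨(Walk.cons h w).copy rfl he, ?_⟩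
    rw [Walk.length_copy, Walk.length_cons, hw]

-- Going around in the two directions gives walks whose lengths add up to the odd number m + 5 when
-- that is the cycle length, so one of them is odd. Distinct positions are needed: a walk of length
-- 0 cannot change the second coordinate.
open Fin.NatCast in
lemma blowUp_exists_walk_of_val_sub {m t : ℕ} {i j : Fin (m + 2)} (hij : i ≠ j) (a b : Fin t) :
    ∃ w : (blowUp (cycleGraph (m + 2)) t).Walk (i, a) (j, b), w.length = (j - i).val := by
  have hpos : (j - i).val ≠ 0 := by
    intro h
    have : j - i = 0 := Fin.ext h
    exact hij (sub_eq_zero.1 this).symm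
  obtain ⟨d, hd⟩ := Nat.exists_eq_succ_of_ne_zero hpos
  obtain ⟨w, hw⟩ := blowUp_exists_walk d i a b
  have he : ((i + ((d + 1 : ℕ) : Fin (m + 2)), b) : Fin (m + 2) × Fin t) = (j, b) := by
    have : d + 1 = (j - i).val := by omega
    rw [this, Fin.cast_val_eq_self]
    simp
  exact ⟨w.copy rfl he, by rw [Walk.length_copy, hw, hd]⟩

/-- In a graph without closed walks of length `m + 3`, a vertex outside or inside a blow-up of
`C_{m+5}` sees only positions at cyclic distance `0` or `2` from each other. -/
lemma sub_eq_two_of_adj_blowUp {m t : ℕ} (hm : Even m) {V : Type*} {H : SimpleGraph V}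
    (hH : IsEmpty (cycleGraph (m + 3) →g H)) (φ : blowUp (cycleGraph (m + 5)) t →g H)
    {w : V} {i j : Fin (m + 5)} {a b : Fin t} (hij : i ≠ j)
    (hi : H.Adj w (φ (i, a))) (hj : H.Adj w (φ (j, b))) : j - i = 2 ∨ i - j = 2 := by
  have main : ∀ {i j : Fin (m + 5)} {a b : Fin t}, i ≠ j → H.Adj w (φ (i, a)) →
      H.Adj w (φ (j, b)) → Odd (j - i).val → i - j = 2 := by
    intro i j a b hij hi hj hodd
    by_contra hne
    obtain ⟨p, hp⟩ := blowUp_exists_walk_of_val_sub hij a b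
    -- This closed walk through `w` has odd length. Unless j - i = m + 3, the length is at most m +
    -- 3 and can be padded to exactly m + 3, which is forbidden.
    let q : H.Walk w w := Walk.cons hi ((p.map φ).concat hj.symm)
    have hq : q.length = (j - i).val + 2 := by simp [q, hp]
    have hlt : (j - i).val < m + 5 := (j - i).isLt
    have hne' : (j - i).val ≠ m + 3 := by
      intro h
      apply hne
      have h2 : i - j = -(j - i) := by abel
      rw [h2]
      apply Fin.ext
      rw [Fin.val_neg']
      rw [h]
      have : m + 5 - (m + 3) = 2 := by omega
      rw [this]
      rfl
    obtain ⟨c, hc⟩ := hodd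
    obtain ⟨d, hd⟩ := hm
    obtain ⟨q', hq'⟩ := q.exists_closed_length_add (by omega) (d - c)
    have : q'.length = (m + 1) + 2 := by omega
    exact hH.elim (q'.nonempty_cycleGraph_hom this).some
  rcases Nat.even_or_odd (j - i).val with h | h
  · left
    refine main hij.symm hj hi ?_
    have h2 : i - j = -(j - i) := by abel
    have hpos : (j - i).val ≠ 0 := by
      intro h
      have : j - i = 0 := Fin.ext h
      exact hij (sub_eq_zero.1 this).symm
    have hlt : (j - i).val < m + 5 := (j - i).isLt
    rw [h2, Fin.val_neg', Nat.mod_eq_of_lt (by omega)]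
    obtain ⟨c, hc⟩ := h
    obtain ⟨d, hd⟩ := hm
    exact ⟨d + 2 - c, by omega⟩
  · right
    exact main hij hi hj h

/-- Going around three such positions would give ±2 ± 2 ± 2 = 0 modulo m + 5, but an odd modulus of
at least 5 divides neither 2 nor 6. -/
lemma card_le_two_of_sub_eq_two {m : ℕ} (hm : Even m) (I : Finset (Fin (m + 5)))
    (hI : ∀ i ∈ I, ∀ j ∈ I, i ≠ j → j - i = 2 ∨ i - j = 2) : I.card ≤ 2 := by
  by_contra hcon
  obtain ⟨a, b, c, ha, hb, hc, hab, hac, hbc⟩ := Finset.two_lt_card_iff.1 (not_le.1 hcon)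
  obtain ⟨d, hd⟩ := hm
  have aux : ∀ x y : Fin (m + 5), y - x = 2 → y.val = x.val + 2 ∨ y.val + (m + 5) = x.val + 2 := by
    intro x y h
    have hy : y = x + 2 := by rw [← h]; abel
    have h2 : ((2 : Fin (m + 5)) : ℕ) = 2 := rfl
    have := congrArg Fin.val hy
    rw [Fin.val_add_eq_ite, h2] at this
    split_ifs at this <;> omega
  have h1 := hI a ha b hb hab
  have h2 := hI a ha c hc hac
  have h3 := hI b hb c hc hbc
  have hla := a.isLt
  have hlb := b.isLt
  have hlc := c.isLt
  rcases h1 with h1 | h1 <;> rcases h2 with h2 | h2 <;> rcases h3 with h3 | h3 <;>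
    have h1 := aux _ _ h1 <;> have h2 := aux _ _ h2 <;> have h3 := aux _ _ h3 <;>
    omega

/-! ### Lower bound: the Latin square construction -/

/-- The union of a family of subgraphs of the complete graph. -/
def unionGraph {X : Type*} (P : Finset (⊤ : SimpleGraph X).Subgraph) : SimpleGraph X where
  Adj x y := ∃ A ∈ P, A.Adj x y
  symm := ⟨fun _ _ ⟨A, hA, h⟩ => ⟨A, hA, h.symm⟩⟩
  loopless := ⟨fun _ ⟨_, _, h⟩ => h.ne rfl⟩

lemma HasRainbowCopy.nonempty_hom_unionGraph {W X : Type*} {G : SimpleGraph W}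
    {P : Finset (⊤ : SimpleGraph X).Subgraph} (h : HasRainbowCopy G P) :
    Nonempty (G →g unionGraph P) := by
  obtain ⟨f, c, -, h⟩ := h
  refine ⟨⟨f, fun {a b} hab => ?_⟩⟩
  have := h ⟨s(a, b), hab⟩
  exact ⟨_, this.1, by simpa using this.2⟩

/-- A sequence alternating between `a` and `b`, closed up at the last place by `a + b`. -/
def alternating {m q : ℕ} (a b : Fin q) (i : Fin (m + 1)) : Fin q :=
  if i = Fin.last m then a + b else if Even i.val then a else b

/-- Since m + 4 is even, the entry before the last is b and the first is a. Hence cyclic neighbours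
always show two different ones among a, b, a + b, and these determine the pair. -/
lemma alternating_inj {m q : ℕ} [NeZero q] (hm : Even m) {a b a' b' : Fin q} (i : Fin (m + 4 + 1))
    (h1 : alternating a b i = alternating a' b' i)
    (h2 : alternating a b (i + 1) = alternating a' b' (i + 1)) : a = a' ∧ b = b' := by
  have hm4 : Even (m + 4) := by simpa [parity_simps] using hm
  unfold alternating at h1 h2
  induction i using Fin.lastCases with
  | last =>
    have h0 : (0 : Fin (m + 4 + 1)) ≠ Fin.last (m + 4) := by
      intro h; simpa using congrArg Fin.val h
    simp [h0] at h1 h2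
    subst h2
    simpa using h1
  | cast i =>
    rw [Fin.coeSucc_eq_succ] at h2
    rw [if_neg (Fin.castSucc_lt_last i).ne, if_neg (Fin.castSucc_lt_last i).ne] at h1
    by_cases hi : i.succ = Fin.last (m + 4)
    · rw [if_pos hi, if_pos hi] at h2
      have hi' : i.val + 1 = m + 4 := by simpa using congrArg Fin.val hi
      have hodd : ¬ Even i.val := by
        intro h
        rw [← hi', Nat.even_add_one] at hm4
        exact hm4 h
      simp only [Fin.val_castSucc, hodd, if_false] at h1
      subst h1
      simpa using h2
    · rw [if_neg hi, if_neg hi] at h2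
      simp only [Fin.val_castSucc, Fin.val_succ, Nat.even_add_one] at h1 h2
      by_cases he : Even i.val
      · simp only [he, if_true, not_true, if_false] at h1 h2
        exact ⟨h1, h2⟩
      · simp only [he, if_false, not_false_iff, if_true] at h1 h2
        exact ⟨h2, h1⟩

/-- The copy of `C_{m+5}(t)` with parameters `a`, `b` in a blow-up of `C_{m+5}`. -/
def latinCopy {m q t n : ℕ} (e : Fin (m + 4 + 1) × Fin q × Fin t ↪ Fin n) (ab : Fin q × Fin q) :
    Copy (blowUp (cycleGraph (m + 4 + 1)) t) (⊤ : SimpleGraph (Fin n)) where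
  toHom := ⟨fun v => e (v.1, alternating ab.1 ab.2 v.1, v.2), fun {u v} h => by
    rw [top_adj]
    intro h'
    have := e.injective h'
    simp only [Prod.mk.injEq] at this
    have h2 : (cycleGraph (m + 4 + 1)).Adj u.1 v.1 := h
    exact h2.ne this.1⟩
  injective' u v h := by
    have := e.injective h
    simp only [Prod.mk.injEq] at this
    exact Prod.ext this.1 this.2.2

lemma latinCopy_adj {m q t n : ℕ} (e : Fin (m + 4 + 1) × Fin q × Fin t ↪ Fin n)
    (ab : Fin q × Fin q) (x y : Fin n) : (latinCopy e ab).toSubgraph.Adj x y ↔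
      ∃ u v : Fin (m + 4 + 1) × Fin t, (cycleGraph (m + 4 + 1)).Adj u.1 v.1 ∧
        e (u.1, alternating ab.1 ab.2 u.1, u.2) = x ∧
        e (v.1, alternating ab.1 ab.2 v.1, v.2) = y := by
  rfl

lemma latinCopy_eq_of_adj {m q t n : ℕ} [NeZero q] (hm : Even m)
    (e : Fin (m + 4 + 1) × Fin q × Fin t ↪ Fin n) {ab ab' : Fin q × Fin q} {x y : Fin n}
    (h : (latinCopy e ab).toSubgraph.Adj x y) (h' : (latinCopy e ab').toSubgraph.Adj x y) :
    ab = ab' := by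
  rw [latinCopy_adj] at h h'
  obtain ⟨u, v, huv, hu, hv⟩ := h
  obtain ⟨u', v', huv', hu', hv'⟩ := h'
  have h1 := e.injective (hu.trans hu'.symm)
  have h2 := e.injective (hv.trans hv'.symm)
  simp only [Prod.mk.injEq] at h1 h2
  obtain ⟨h11, h12, -⟩ := h1
  obtain ⟨h21, h22, -⟩ := h2
  rw [← h11] at h12
  rw [← h21] at h22
  have : ab.1 = ab'.1 ∧ ab.2 = ab'.2 := by
    rcases (cycleGraph_adj (n := m + 3)).1 huv with hs | hs
    · have hs' : u.1 = v.1 + 1 := by rw [← hs]; abel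
      rw [hs'] at h12
      exact alternating_inj hm _ h22 h12
    · have hs' : v.1 = u.1 + 1 := by rw [← hs]; abel
      rw [hs'] at h22
      exact alternating_inj hm _ h12 h22
  exact Prod.ext this.1 this.2

lemma sq_mem_multicolorSizes {m q t n : ℕ} (hm : Even m) (ht : 1 ≤ t) (hq : 1 ≤ q)
    (hn : (m + 5) * (q * t) ≤ n) :
    q ^ 2 ∈ multicolorSizes (blowUp (cycleGraph (m + 5)) t) (cycleGraph (m + 3)) n := by
  classical
  have : NeZero q := ⟨by omega⟩
  have : NeZero t := ⟨by omega⟩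
  obtain ⟨e⟩ : Nonempty (Fin (m + 4 + 1) × Fin q × Fin t ↪ Fin n) :=
    Function.Embedding.nonempty_of_card_le (by simpa using hn)
  have hadj : ∀ ab, ∃ x y, (latinCopy e ab).toSubgraph.Adj x y := fun ab =>
    ⟨_, _, (latinCopy_adj e ab _ _).2 ⟨(0, 0), (1, 0), by
      rw [cycleGraph_adj]; right; simp, rfl, rfl⟩⟩
  have hinj : Function.Injective fun ab => (latinCopy e ab).toSubgraph := by
    intro ab ab' h
    obtain ⟨x, y, hxy⟩ := hadj ab
    exact latinCopy_eq_of_adj hm e hxy (by simpa only [← h] using hxy)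
  refine ⟨Finset.univ.image fun ab => (latinCopy e ab).toSubgraph, ⟨?_, ?_⟩, ?_, ?_⟩
  · simp only [Finset.mem_image, Finset.mem_univ, true_and]
    rintro _ ⟨ab, rfl⟩
    exact ⟨(latinCopy e ab).isoToSubgraph⟩
  · simp only [Finset.mem_image, Finset.mem_univ, true_and]
    rintro _ ⟨ab, rfl⟩ _ ⟨ab', rfl⟩ hne
    rw [Set.disjoint_left]
    intro s hs hs'
    induction s using Sym2.ind with
    | _ x y => exact hne (by rw [latinCopy_eq_of_adj hm e hs hs'])
  · intro h
    obtain ⟨f⟩ := h.nonempty_hom_unionGraph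
    have hodd : Odd (m + 1 + 2) := by simpa [parity_simps] using hm
    -- Forgetting everything but the position maps the union to C_{m+5}; values of `invFun` outside
    -- the range of `e` are irrelevant, as no edge meets them.
    refine (isEmpty_cycleGraph_hom_cycleGraph (b := m + 3) hodd (by omega)).elim
      (Hom.comp ⟨fun x => (Function.invFun e x).1, fun {x y} hxy => ?_⟩ f)
    obtain ⟨A, hA, hxy⟩ := hxy
    simp only [Finset.mem_image, Finset.mem_univ, true_and] at hA
    obtain ⟨ab, rfl⟩ := hA
    rw [latinCopy_adj] at hxy
    obtain ⟨u, v, huv, rfl, rfl⟩ := hxy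
    simpa only [Function.leftInverse_invFun e.injective _] using huv
  · rw [Finset.card_image_of_injective _ hinj]
    simp [sq]

/-- A copy of `F` in a family maps to the union of the family. -/
def copyHom {V X : Type*} {F : SimpleGraph V} {P : Finset (⊤ : SimpleGraph X).Subgraph}
    {A : (⊤ : SimpleGraph X).Subgraph} (hA : A ∈ P) (f : F ≃g A.coe) : F →g unionGraph P where
  toFun v := f v
  map_rel' h := ⟨A, hA, f.map_rel_iff.2 h⟩

/-! ### Double counting when the union has no closed walk of length m + 3 -/

section DoubleCounting

variable {X : Type*} [Fintype X] {m t : ℕ} {Q : Finset (⊤ : SimpleGraph X).Subgraph}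
  {A : (⊤ : SimpleGraph X).Subgraph}

open Classical in
lemma card_verts_of_iso_blowUp (f : blowUp (cycleGraph (m + 5)) t ≃g A.coe) :
    (Finset.univ.filter (· ∈ A.verts)).card = (m + 5) * t := by
  have h := Fintype.card_congr f.toEquiv
  rw [Fintype.card_prod, Fintype.card_fin, Fintype.card_fin] at h
  rw [h, Fintype.card_subtype]

-- The neighbours of `w` occupy at most two positions of the blow-up, of t vertices each.
open Classical in
lemma card_adj_verts_le (hm : Even m) (hA : A ∈ Q)
    (hQ : IsEmpty (cycleGraph (m + 3) →g unionGraph Q))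
    (f : blowUp (cycleGraph (m + 5)) t ≃g A.coe) (w : X) :
    (Finset.univ.filter fun v => v ∈ A.verts ∧ (unionGraph Q).Adj v w).card ≤ 2 * t := by
  set I : Finset (Fin (m + 5)) :=
    Finset.univ.filter fun i => ∃ a : Fin t, (unionGraph Q).Adj w (copyHom hA f (i, a)) with hI
  have hIcard : I.card ≤ 2 := by
    refine card_le_two_of_sub_eq_two hm I fun i hi j hj hij => ?_
    simp only [hI, Finset.mem_filter, Finset.mem_univ, true_and] at hi hj
    obtain ⟨a, ha⟩ := hi
    obtain ⟨b, hb⟩ := hj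
    exact sub_eq_two_of_adj_blowUp hm hQ (copyHom hA f) hij ha hb
  have hsub : (Finset.univ.filter fun v => v ∈ A.verts ∧ (unionGraph Q).Adj v w) ⊆
      (I ×ˢ (Finset.univ : Finset (Fin t))).image (copyHom hA f) := by
    intro v hv
    simp only [Finset.mem_filter, Finset.mem_univ, true_and] at hv
    obtain ⟨hv, hvw⟩ := hv
    obtain ⟨⟨i, a⟩, hia⟩ := f.surjective ⟨v, hv⟩
    have hv' : copyHom hA f (i, a) = v := congrArg Subtype.val hia
    refine Finset.mem_image.2 ⟨(i, a), ?_, hv'⟩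
    simp only [hI, Finset.mem_product, Finset.mem_filter, Finset.mem_univ, true_and, and_true]
    exact ⟨a, by rw [hv']; exact hvw.symm⟩
  calc _ ≤ _ := Finset.card_le_card hsub
    _ ≤ _ := Finset.card_image_le
    _ = I.card * t := by simp
    _ ≤ 2 * t := Nat.mul_le_mul_right _ hIcard

open Classical in
lemma le_card_neighbors_of_iso_blowUp (f : blowUp (cycleGraph (m + 5)) t ≃g A.coe) {v : X}
    (hv : v ∈ A.verts) : 2 * t ≤ (Finset.univ.filter fun w => A.Adj v w).card := by
  obtain ⟨⟨i, a⟩, hia⟩ := f.surjective ⟨v, hv⟩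
  have hne : i + 1 ≠ i - 1 := by
    intro h
    have h2 : (1 : Fin (m + 5)) + 1 = 0 := by
      have := congrArg (fun x => x - i + 1) h
      rw [show i + 1 - i + 1 = 1 + 1 by abel, show i - 1 - i + 1 = 0 by abel] at this
      exact this
    have h3 : (1 + 1) % (m + 5) = 0 := congrArg Fin.val h2
    rw [Nat.mod_eq_of_lt (by omega)] at h3
    omega
  have hsub : (({i + 1, i - 1} : Finset (Fin (m + 5))) ×ˢ (Finset.univ : Finset (Fin t))).image
      (fun u => (f u : X)) ⊆ Finset.univ.filter fun w => A.Adj v w := by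
    intro w hw
    obtain ⟨⟨j, b⟩, hj, rfl⟩ := Finset.mem_image.1 hw
    simp only [Finset.mem_product, Finset.mem_insert, Finset.mem_singleton, Finset.mem_univ,
      and_true] at hj
    have hadj : (blowUp (cycleGraph (m + 5)) t).Adj (i, a) (j, b) := by
      change (cycleGraph (m + 3 + 2)).Adj i j
      rw [cycleGraph_adj]
      rcases hj with rfl | rfl
      · right; abel
      · left; abel
    have := f.map_rel_iff.2 hadj
    rw [hia] at this
    simpa using this
  have hinj : Function.Injective fun u => (f u : X) := Subtype.val_injective.comp f.injective
  calc 2 * t = _ := by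
        rw [Finset.card_image_of_injective _ hinj, Finset.card_product, Finset.card_pair hne, Finset.card_univ, Fintype.card_fin]
    _ ≤ _ := Finset.card_le_card hsub

-- Copies through `v` are edge-disjoint, so their neighbourhoods of `v` are disjoint, each of size
-- at least 2t.
open Classical in
lemma mul_card_containing_le (hQ : IsEdgeDisjointCopies (blowUp (cycleGraph (m + 5)) t) Q)
    (v : X) : 2 * t * (Q.filter fun A => v ∈ A.verts).card ≤
      (Finset.univ.filter fun w => (unionGraph Q).Adj v w).card := by
  calc 2 * t * (Q.filter fun A => v ∈ A.verts).card
      = ∑ A ∈ Q.filter fun A => v ∈ A.verts, 2 * t := by simp [mul_comm]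
    _ ≤ ∑ A ∈ Q.filter fun A => v ∈ A.verts, (Finset.univ.filter fun w => A.Adj v w).card := by
        refine Finset.sum_le_sum fun A hA => ?_
        rw [Finset.mem_filter] at hA
        obtain ⟨f⟩ := hQ.1 A hA.1
        exact le_card_neighbors_of_iso_blowUp f hA.2
    _ = ((Q.filter fun A => v ∈ A.verts).biUnion fun A =>
          Finset.univ.filter fun w => A.Adj v w).card := by
        rw [Finset.card_biUnion]
        intro A hA B hB hAB
        rw [Finset.mem_coe, Finset.mem_filter] at hA hB
        rw [Function.onFun, Finset.disjoint_left]
        intro w hw hw'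
        simp only [Finset.mem_filter, Finset.mem_univ, true_and] at hw hw'
        exact Set.disjoint_left.1 (hQ.2 A hA.1 B hB.1 hAB)
          (Subgraph.mem_edgeSet.2 hw) (Subgraph.mem_edgeSet.2 hw')
    _ ≤ _ := by
        refine Finset.card_le_card fun w hw => ?_
        simp only [Finset.mem_biUnion, Finset.mem_filter, Finset.mem_univ, true_and] at hw ⊢
        obtain ⟨A, ⟨hA, -⟩, h⟩ := hw
        exact ⟨A, hA, h⟩

/-- If the union of a family of edge-disjoint copies of `C_{m+5}(t)` has no closed walk of length
`m + 3`, then the family has at most `n² / ((m + 5) t)²` members. -/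
lemma sq_mul_card_le_of_isEmpty_hom (hm : Even m) (ht : 1 ≤ t)
    (hQ : IsEdgeDisjointCopies (blowUp (cycleGraph (m + 5)) t) Q)
    (hempty : IsEmpty (cycleGraph (m + 3) →g unionGraph Q)) :
    ((m + 5) * t) ^ 2 * Q.card ≤ Fintype.card X ^ 2 := by
  classical
  set a : X → ℕ := fun v => (Q.filter fun A => v ∈ A.verts).card with ha
  have hsum : ∀ g : X → ℕ, ∑ v, a v * g v = ∑ A ∈ Q, ∑ v ∈ Finset.univ.filter (· ∈ A.verts), g v := by
    intro g
    simp_rw [ha, Finset.card_filter, Finset.sum_mul, Finset.sum_filter, ite_mul, one_mul, zero_mul]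
    exact Finset.sum_comm
  have h1 : ∑ v, a v = (m + 5) * t * Q.card := by
    have := hsum fun _ => 1
    simp only [mul_one, Finset.sum_const, smul_eq_mul] at this
    rw [this, Finset.sum_congr rfl fun A hA =>
      card_verts_of_iso_blowUp (hQ.1 A hA).some, Finset.sum_const, smul_eq_mul, mul_comm]
  -- Count triples (A, v, w) with v in A and vw an edge of the union: by degrees of v from below, by
  -- pairs (A, w) from above.
  have h2 : 2 * t * ∑ v, a v ^ 2 ≤ 2 * t * (Q.card * Fintype.card X) := by
    calc 2 * t * ∑ v, a v ^ 2 = ∑ v, a v * (2 * t * a v) := by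
          rw [Finset.mul_sum]; exact Finset.sum_congr rfl fun v _ => by ring
      _ ≤ ∑ v, a v * (Finset.univ.filter fun w => (unionGraph Q).Adj v w).card :=
          Finset.sum_le_sum fun v _ => Nat.mul_le_mul_left _ (mul_card_containing_le hQ v)
      _ = ∑ A ∈ Q, ∑ w, (Finset.univ.filter fun v => v ∈ A.verts ∧ (unionGraph Q).Adj v w).card := by
          rw [hsum]
          refine Finset.sum_congr rfl fun A _ => ?_
          simp_rw [Finset.card_filter]
          rw [Finset.sum_comm]
          refine Finset.sum_congr rfl fun w _ => ?_
          rw [Finset.sum_filter]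
          exact Finset.sum_congr rfl fun v _ => by rw [ite_and]
      _ ≤ ∑ A ∈ Q, ∑ w : X, 2 * t :=
          Finset.sum_le_sum fun A hA => Finset.sum_le_sum fun w _ =>
            card_adj_verts_le hm hA hempty (hQ.1 A hA).some w
      _ = _ := by simp; ring
  have h3 : ∑ v, a v ^ 2 ≤ Q.card * Fintype.card X := Nat.le_of_mul_le_mul_left h2 (by omega)
  have h4 : (∑ v, a v) ^ 2 ≤ Fintype.card X * ∑ v, a v ^ 2 := by
    simpa using sq_sum_le_card_mul_sum_sq (s := (Finset.univ : Finset X)) (f := a)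
  rcases Nat.eq_zero_or_pos Q.card with h0 | hpos
  · simp [h0]
  · refine Nat.le_of_mul_le_mul_left ?_ hpos
    calc Q.card * (((m + 5) * t) ^ 2 * Q.card) = (∑ v, a v) ^ 2 := by rw [h1]; ring
      _ ≤ Fintype.card X * (Q.card * Fintype.card X) := h4.trans (Nat.mul_le_mul_left _ h3)
      _ = Q.card * Fintype.card X ^ 2 := by ring

end DoubleCounting

/-! ### Few homomorphisms without a rainbow copy -/

section RainbowCounting

variable {X : Type*}

open Classical in
/-- A member of the family `P` containing the edge `s`, if there is one. -/
noncomputable def memberThrough (P : Finset (⊤ : SimpleGraph X).Subgraph) (s : Sym2 X) :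
    (⊤ : SimpleGraph X).Subgraph :=
  if h : ∃ A ∈ P, s ∈ A.edgeSet then h.choose else ⊥

lemma memberThrough_spec {P : Finset (⊤ : SimpleGraph X).Subgraph} {x y : X}
    (h : (unionGraph P).Adj x y) :
    memberThrough P s(x, y) ∈ P ∧ s(x, y) ∈ (memberThrough P s(x, y)).edgeSet := by
  have h' : ∃ A ∈ P, s(x, y) ∈ A.edgeSet := h
  rw [memberThrough, dif_pos h']
  exact h'.choose_spec

/-- Colour each edge by its member. Of two distinct edges, the second has an endpoint off the first,
and its image would lie in the common member if the colours agreed. -/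
lemma hasRainbowCopy_of_forall_notMem {W : Type*} {G : SimpleGraph W}
    {P : Finset (⊤ : SimpleGraph X).Subgraph} (x : W → X)
    (hx : ∀ u v, G.Adj u v → (unionGraph P).Adj (x u) (x v))
    (hne : ∀ a i j, a ≠ i → a ≠ j → x a ≠ x i ∧ x a ∉ (memberThrough P s(x i, x j)).verts) :
    HasRainbowCopy G P := by
  have hinj : Function.Injective x := by
    intro a b hab
    by_contra h
    exact (hne a b b h h).1 hab
  have hspec : ∀ e : G.edgeSet, memberThrough P ((e : Sym2 W).map x) ∈ P ∧
      (e : Sym2 W).map x ∈ (memberThrough P ((e : Sym2 W).map x)).edgeSet := by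
    rintro ⟨e, he⟩
    induction e using Sym2.ind with
    | _ u v => exact memberThrough_spec (hx u v he)
  refine ⟨⟨x, hinj⟩, fun e => memberThrough P ((e : Sym2 W).map x), ?_, fun e => hspec e⟩
  rintro ⟨e, he⟩ ⟨e', he'⟩ heq
  by_contra hee
  simp only at heq
  have hmem := (hspec ⟨e', he'⟩).2
  simp only at hmem
  rw [← heq] at hmem
  induction e using Sym2.ind with
  | _ i j =>
  induction e' using Sym2.ind with
  | _ p q =>
  have hpq : p ≠ q := G.ne_of_adj he'
  have hp : x p ∈ (memberThrough P s(x i, x j)).verts := Subgraph.edge_vert _ hmem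
  have hq : x q ∈ (memberThrough P s(x i, x j)).verts :=
    Subgraph.edge_vert _ (Subgraph.Adj.symm hmem)
  by_cases h1 : p ≠ i ∧ p ≠ j
  · exact (hne p i j h1.1 h1.2).2 hp
  by_cases h2 : q ≠ i ∧ q ≠ j
  · exact (hne q i j h2.1 h2.2).2 hq
  apply hee
  rw [Subtype.mk.injEq, Sym2.eq_iff]
  grind

/-- Deleting coordinate `a` has fibres of size at most K, because the other coordinates fix the set
containing `x a`. -/
lemma card_filter_mem_le [Fintype X] [DecidableEq X] {M K : ℕ}
    (T : X → X → Finset X) (hT : ∀ u v, (T u v).card ≤ K) {a i j : Fin (M + 1)}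
    (hi : a ≠ i) (hj : a ≠ j) :
    (Finset.univ.filter fun x : Fin (M + 1) → X => x a ∈ T (x i) (x j)).card ≤
      K * Fintype.card X ^ M := by
  refine (Finset.card_le_mul_card_image (f := fun x => a.removeNth x) _ K ?_).trans ?_
  · intro y hy
    obtain ⟨x₀, -, rfl⟩ := Finset.mem_image.1 hy
    refine le_trans ?_ (hT (x₀ i) (x₀ j))
    have hfib : ∀ {x : Fin (M + 1) → X}, a.removeNth x = a.removeNth x₀ →
        ∀ b, a ≠ b → x b = x₀ b := by
      intro x h b hb
      obtain ⟨c, rfl⟩ := Fin.exists_succAbove_eq hb.symm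
      exact congrFun h c
    refine Finset.card_le_card_of_injOn (fun x => x a) ?_ ?_
    · intro x hx
      simp only [Finset.coe_filter, Finset.mem_filter, Finset.mem_univ, true_and,
        Set.mem_ofPred_eq] at hx
      rw [Finset.mem_coe, ← hfib hx.2 i hi, ← hfib hx.2 j hj]
      exact hx.1
    · intro x hx x' hx' h
      simp only [Finset.coe_filter, Finset.mem_filter, Finset.mem_univ, true_and,
        Set.mem_ofPred_eq] at hx hx'
      funext b
      by_cases hb : a = b
      · rw [← hb]; exact h
      · rw [hfib hx.2 b hb, hfib hx'.2 b hb]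
  · refine Nat.mul_le_mul_left _ ((Finset.card_le_univ _).trans ?_)
    simp

open Classical in
/-- A family of small copies without a rainbow copy of `G` carries few homomorphisms from `G`. -/
lemma card_hom_le_of_not_hasRainbowCopy [Fintype X] {M K : ℕ} {G : SimpleGraph (Fin (M + 1))}
    {P : Finset (⊤ : SimpleGraph X).Subgraph}
    (hK : ∀ A ∈ P, (Finset.univ.filter (· ∈ A.verts)).card ≤ K) (hP : ¬ HasRainbowCopy G P) :
    (Finset.univ.filter fun x : Fin (M + 1) → X =>
      ∀ u v, G.Adj u v → (unionGraph P).Adj (x u) (x v)).card ≤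
      (M + 1) ^ 3 * ((K + 1) * Fintype.card X ^ M) := by
  -- Adding `u` itself also covers the failures of injectivity; hence K + 1.
  set T : X → X → Finset X := fun u v =>
    insert u (Finset.univ.filter (· ∈ (memberThrough P s(u, v)).verts)) with hTdef
  have hT : ∀ u v, (T u v).card ≤ K + 1 := by
    intro u v
    refine (Finset.card_insert_le _ _).trans (Nat.succ_le_succ ?_)
    by_cases h : ∃ A ∈ P, s(u, v) ∈ A.edgeSet
    · exact hK _ (memberThrough_spec (P := P) (x := u) (y := v) h).1
    -- The default member `⊥` has no vertices.
    · rw [memberThrough, dif_neg h]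
      simp
  have hsub : (Finset.univ.filter fun x : Fin (M + 1) → X =>
      ∀ u v, G.Adj u v → (unionGraph P).Adj (x u) (x v)) ⊆
      (Finset.univ.filter fun p : Fin (M + 1) × Fin (M + 1) × Fin (M + 1) =>
        p.1 ≠ p.2.1 ∧ p.1 ≠ p.2.2).biUnion fun p =>
        Finset.univ.filter fun x : Fin (M + 1) → X => x p.1 ∈ T (x p.2.1) (x p.2.2) := by
    intro x hx
    by_contra hcon
    refine hP (hasRainbowCopy_of_forall_notMem x (Finset.mem_filter.1 hx).2 fun a i j hi hj => ?_)
    have : x a ∉ T (x i) (x j) := fun h => hcon <| Finset.mem_biUnion.2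
      ⟨(a, i, j), Finset.mem_filter.2 ⟨Finset.mem_univ _, hi, hj⟩,
        Finset.mem_filter.2 ⟨Finset.mem_univ _, h⟩⟩
    simpa [hTdef] using this
  refine (Finset.card_le_card hsub).trans (Finset.card_biUnion_le.trans ?_)
  refine (Finset.sum_le_card_nsmul _ _ ((K + 1) * Fintype.card X ^ M) fun p hp => ?_).trans ?_
  · have hp' := (Finset.mem_filter.1 hp).2
    exact card_filter_mem_le T hT hp'.1 hp'.2
  · rw [smul_eq_mul]
    refine Nat.mul_le_mul_right _ ((Finset.card_le_univ _).trans ?_)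
    simp only [Fintype.card_prod, Fintype.card_fin]
    exact le_of_eq (by ring)

end RainbowCounting

/-! ### Cycle counting in regular pairs -/

lemma mul_card_le_card_of_injective2 {α β γ : Type*} {A : Finset α} {N : α → Finset β}
    {B : Finset γ} {g : α → β → γ} (hg : Function.Injective2 g) {c : ℝ}
    (hN : ∀ a ∈ A, c ≤ (N a).card) (hB : ∀ a ∈ A, ∀ b ∈ N a, g a b ∈ B) :
    c * A.card ≤ B.card := by
  have h1 : (A.sigma N).card ≤ B.card := by
    refine Finset.card_le_card_of_injOn (fun p => g p.1 p.2) ?_ ?_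
    · rintro ⟨a, b⟩ hp
      rw [Finset.mem_coe, Finset.mem_sigma] at hp
      exact hB a hp.1 b hp.2
    · rintro ⟨a, b⟩ - ⟨a', b'⟩ - h
      obtain ⟨rfl, rfl⟩ := hg h
      rfl
  calc c * A.card = ∑ a ∈ A, c := by simp [mul_comm]
    _ ≤ ∑ a ∈ A, ((N a).card : ℝ) := Finset.sum_le_sum hN
    _ = ((A.sigma N).card : ℝ) := by rw [Finset.card_sigma]; push_cast; rfl
    _ ≤ B.card := by exact_mod_cast h1

section RegularCounting

variable {X : Type*} {G : SimpleGraph X} [DecidableRel G.Adj] {ε : ℝ}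

/-- The pair `(U, V)` is `ε`-uniform with density at least `2 ε`. -/
def IsRegularDense (G : SimpleGraph X) [DecidableRel G.Adj] (ε : ℝ) (U V : Finset X) : Prop :=
  G.IsUniform ε U V ∧ 2 * ε ≤ G.edgeDensity U V

lemma IsRegularDense.symm {U V : Finset X} (h : IsRegularDense G ε U V) :
    IsRegularDense G ε V U :=
  ⟨h.1.symm, by rw [edgeDensity_comm]; exact h.2⟩

/-- Uniformity costs less than ε of the density 2ε, so more than ε survives. -/
lemma IsRegularDense.lt_card_interedges {U V S T : Finset X} (h : IsRegularDense G ε U V)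
    (hS : S ⊆ U) (hT : T ⊆ V) (hSU : U.card * ε ≤ S.card) (hTV : V.card * ε ≤ T.card)
    (hS0 : S.Nonempty) (hT0 : T.Nonempty) :
    ε * (S.card * T.card) < (G.interedges S T).card := by
  have h1 := (abs_lt.1 (h.1 hS hT hSU hTV)).1
  have h2 := h.2
  have h3 : ε < (G.edgeDensity S T : ℝ) := by linarith
  have hpos : (0 : ℝ) < S.card * T.card := by
    have := hS0.card_pos
    have := hT0.card_pos
    positivity
  rw [edgeDensity_def] at h3
  push_cast at h3
  rwa [lt_div_iff₀ hpos] at h3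

/-- The vertices of `U` with a typical number of neighbours in `T`. -/
noncomputable def typicalVertices (G : SimpleGraph X) [DecidableRel G.Adj] (ε : ℝ) (U T : Finset X) : Finset X :=
  open Classical in U.filter fun u => ε * T.card ≤ (T.filter (G.Adj u)).card

/-- The atypical vertices send too few edges to `T` to form an ε-fraction of `U`. -/
lemma IsRegularDense.le_card_typicalVertices {U V T : Finset X} (h : IsRegularDense G ε U V)
    (hT : T ⊆ V) (hTV : V.card * ε ≤ T.card) (hU0 : U.Nonempty) (hT0 : T.Nonempty) :
    (1 - ε) * U.card ≤ (typicalVertices G ε U T).card := by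
  classical
  have hε : 0 < ε := h.1.pos
  set B := U.filter fun u => ¬ ε * T.card ≤ (T.filter (G.Adj u)).card with hB
  have hsum : (typicalVertices G ε U T).card + B.card = U.card := by
    rw [typicalVertices, hB]
    convert Finset.card_filter_add_card_filter_not (s := U)
      (fun u => ε * T.card ≤ (T.filter (G.Adj u)).card) using 3
  have hUpos : (0 : ℝ) < U.card := by exact_mod_cast hU0.card_pos
  have hBlt : (B.card : ℝ) < U.card * ε := by
    by_contra hcon
    push Not at hcon
    have hB0 : B.Nonempty := by
      rw [← Finset.card_pos]
      have : (0 : ℝ) < B.card := lt_of_lt_of_le (by positivity) hcon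
      exact_mod_cast this
    have h1 := h.lt_card_interedges (Finset.filter_subset _ _) hT hcon hTV hB0 hT0
    have h2 : (G.interedges B T).card = ∑ u ∈ B, (T.filter (G.Adj u)).card := by
      rw [interedges_def, Finset.card_filter, Finset.sum_product]
      exact Finset.sum_congr rfl fun u _ => (Finset.card_filter _ _).symm
    have h3 : ((G.interedges B T).card : ℝ) ≤ ∑ u ∈ B, ε * T.card := by
      rw [h2]
      push_cast
      exact Finset.sum_le_sum fun u hu => (not_le.1 (Finset.mem_filter.1 hu).2).le
    rw [Finset.sum_const, nsmul_eq_mul] at h3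
    linarith
  have hsum' : ((typicalVertices G ε U T).card : ℝ) + B.card = U.card := by exact_mod_cast hsum
  linarith

variable [Fintype X] [DecidableEq X]

/-- Walks with `r + 2` vertices starting in `S` and ending in `T`. -/
def walksBetween (G : SimpleGraph X) [DecidableRel G.Adj] (r : ℕ) (S T : Finset X) :
    Finset (Fin (r + 2) → X) :=
  Finset.univ.filter fun p => p 0 ∈ S ∧ p (Fin.last _) ∈ T ∧
    ∀ i : Fin (r + 1), G.Adj (p i.castSucc) (p i.succ)

/-- Induction on r: the vertices of `U 1` typical for `S` form a fraction 1 - ε ≥ ε, so the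
hypothesis applies to them, and each walk found extends back into `S` in at least ε|S| ≥ ε²s ways.
-/
lemma le_card_walksBetween (hε2 : ε ≤ 1 / 2) {s : ℝ} (hs : 0 < s) (r : ℕ) (U : ℕ → Finset X)
    (hU : ∀ i, IsRegularDense G ε (U i) (U (i + 1))) (hUs : ∀ i, s ≤ (U i).card)
    {S T : Finset X} (hS : S ⊆ U 0) (hT : T ⊆ U (r + 1))
    (hSc : (U 0).card * ε ≤ S.card) (hTc : (U (r + 1)).card * ε ≤ T.card) :
    (ε ^ 2 * s) ^ r * (ε ^ 3 * s ^ 2) ≤ (walksBetween G r S T).card := by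
  classical
  have hε : 0 < ε := (hU 0).1.pos
  have hlow : ∀ {i : ℕ} {A : Finset X}, (U i).card * ε ≤ A.card → s * ε ≤ A.card := by
    intro i A h
    exact (mul_le_mul_of_nonneg_right (hUs i) hε.le).trans h
  have hne : ∀ {i : ℕ} {A : Finset X}, (U i).card * ε ≤ A.card → A.Nonempty := by
    intro i A h
    rw [← Finset.card_pos]
    have : (0 : ℝ) < A.card := lt_of_lt_of_le (by positivity) (hlow h)
    exact_mod_cast this
  induction r generalizing U S with
  | zero =>
    have h1 := (hU 0).lt_card_interedges hS hT hSc hTc (hne hSc) (hne hTc)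
    have h2 : (G.interedges S T).card ≤ (walksBetween G 0 S T).card := by
      refine Finset.card_le_card_of_injOn (fun e => ![e.1, e.2]) ?_ ?_
      · rintro ⟨x, y⟩ hxy
        rw [Finset.mem_coe, mk_mem_interedges_iff] at hxy
        rw [Finset.mem_coe, walksBetween, Finset.mem_filter]
        refine ⟨Finset.mem_univ _, hxy.1, hxy.2.1, fun i => ?_⟩
        rw [Fin.eq_zero i]
        exact hxy.2.2
      · rintro ⟨x, y⟩ - ⟨x', y'⟩ - h
        exact Prod.ext (congrFun h 0) (congrFun h 1)
    have h2' : ((G.interedges S T).card : ℝ) ≤ (walksBetween G 0 S T).card := by exact_mod_cast h2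
    have h3 : (s * ε) * (s * ε) ≤ (S.card : ℝ) * T.card :=
      mul_le_mul (hlow hSc) (hlow hTc) (by positivity) (by positivity)
    calc (ε ^ 2 * s) ^ 0 * (ε ^ 3 * s ^ 2) = ε * ((s * ε) * (s * ε)) := by ring
      _ ≤ ε * (S.card * T.card) := mul_le_mul_of_nonneg_left h3 hε.le
      _ ≤ _ := h1.le.trans h2'
  | succ r ih =>
    have hU1 : (U 1).Nonempty := by
      rw [← Finset.card_pos]
      have := lt_of_lt_of_le hs (hUs 1)
      exact_mod_cast this
    have htyp := (hU 0).symm.le_card_typicalVertices hS hSc hU1 (hne hSc)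
    have htyp' : ((U 1).card : ℝ) * ε ≤ (typicalVertices G ε (U 1) S).card := by
      refine le_trans ?_ htyp
      rw [mul_comm]
      exact mul_le_mul_of_nonneg_right (by linarith) (by positivity)
    have hrec := ih (fun i => U (i + 1)) (fun i => hU (i + 1)) (fun i => hUs (i + 1))
      (S := typicalVertices G ε (U 1) S) (Finset.filter_subset _ _) hT htyp' hTc
      (fun {i} {A} h => hlow (i := i + 1) h) (fun {i} {A} h => hne (i := i + 1) h)
    have hstep : ε ^ 2 * s * (walksBetween G r (typicalVertices G ε (U 1) S) T).card ≤
        (walksBetween G (r + 1) S T).card := by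
      refine mul_card_le_card_of_injective2 (N := fun p => S.filter (G.Adj (p 0)))
        (g := fun p y => Fin.cons (α := fun _ => X) y p) ?_ ?_ ?_
      · intro p p' y y' h
        have := Fin.cons_inj.1 h
        exact ⟨this.2, this.1⟩
      · intro p hp
        rw [walksBetween, Finset.mem_filter] at hp
        have h1 := (Finset.mem_filter.1 hp.2.1).2
        have h2 := mul_le_mul_of_nonneg_left (hlow hSc) hε.le
        calc ε ^ 2 * s = ε * (s * ε) := by ring
          _ ≤ _ := h2.trans (by convert h1)
      · intro p hp y hy
        rw [walksBetween, Finset.mem_filter] at hp ⊢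
        rw [Finset.mem_filter] at hy
        refine ⟨Finset.mem_univ _, hy.1, ?_, fun i => ?_⟩
        · have := hp.2.2.1
          rwa [← Fin.succ_last, Fin.cons_succ]
        · induction i using Fin.cases with
          | zero => exact hy.2.symm
          | succ i =>
            rw [← Fin.succ_castSucc, Fin.cons_succ, Fin.cons_succ]
            exact hp.2.2.2 i
    calc (ε ^ 2 * s) ^ (r + 1) * (ε ^ 3 * s ^ 2)
        = ε ^ 2 * s * ((ε ^ 2 * s) ^ r * (ε ^ 3 * s ^ 2)) := by ring
      _ ≤ ε ^ 2 * s * (walksBetween G r (typicalVertices G ε (U 1) S) T).card :=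
          mul_le_mul_of_nonneg_left hrec (by positivity)
      _ ≤ _ := hstep

/-- **Cycle counting lemma**: a cyclic sequence of regular dense pairs contains many closed
walks. -/
lemma le_card_cycleGraph_hom (hε4 : ε ≤ 1 / 4) {s : ℝ} (hs : 0 < s) (r : ℕ) (U : ℕ → Finset X)
    (hU : ∀ i, IsRegularDense G ε (U i) (U (i + 1))) (hUs : ∀ i, s ≤ (U i).card)
    (hcyc : U (r + 3) = U 0) :
    (ε ^ 2 * s) ^ r * (ε ^ 3 * s ^ 2) * (s / 2) ≤
      (Finset.univ.filter fun x : Fin (r + 3) → X =>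
        ∀ u v, (cycleGraph (r + 3)).Adj u v → G.Adj (x u) (x v)).card := by
  have hε : 0 < ε := (hU 0).1.pos
  have hne : ∀ i, (U i).Nonempty := by
    intro i
    rw [← Finset.card_pos]
    have := lt_of_lt_of_le hs (hUs i)
    exact_mod_cast this
  have hmul : ∀ i, ((U i).card : ℝ) * ε ≤ (U i).card := fun i =>
    mul_le_of_le_one_right (by positivity) (by linarith)
  have hlast := hU (r + 2)
  rw [show r + 2 + 1 = r + 3 from rfl, hcyc] at hlast
  have h1 := (hU 0).le_card_typicalVertices subset_rfl (hmul _) (hne _) (hne _)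
  have h2 := hlast.symm.le_card_typicalVertices subset_rfl (hmul _) (hne _) (hne _)
  set A₁ := typicalVertices G ε (U 0) (U (0 + 1))
  set A₂ := typicalVertices G ε (U 0) (U (r + 2))
  -- At most 2ε ≤ 1/2 of `U 0` is atypical for one of its two neighbouring parts.
  have hA : s / 2 ≤ ((A₁ ∩ A₂).card : ℝ) := by
    have h3 : ((A₁ ∪ A₂).card : ℝ) ≤ (U 0).card := by
      exact_mod_cast Finset.card_le_card
        (Finset.union_subset (Finset.filter_subset _ _) (Finset.filter_subset _ _))
    have h4 : ((A₁ ∪ A₂).card : ℝ) + (A₁ ∩ A₂).card = A₁.card + A₂.card := by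
      exact_mod_cast Finset.card_union_add_card_inter A₁ A₂
    have h5 : s / 2 ≤ (1 - 2 * ε) * (U 0).card := by
      nlinarith [hUs 0]
    linarith
  refine (mul_le_mul_of_nonneg_left hA (by positivity)).trans ?_
  refine mul_card_le_card_of_injective2
    (N := fun x => walksBetween G r ((U 1).filter (G.Adj x)) ((U (r + 2)).filter (G.Adj x)))
    (g := fun x p => Fin.cons (α := fun _ => X) x p) (fun x x' p p' h => Fin.cons_inj.1 h) ?_ ?_
  · intro x hx
    rw [Finset.mem_inter] at hx
    have hx1 := (Finset.mem_filter.1 hx.1).2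
    have hx2 := (Finset.mem_filter.1 hx.2).2
    refine le_card_walksBetween (by linarith) hs r (fun i => U (i + 1)) (fun i => hU (i + 1))
      (fun i => hUs (i + 1)) (Finset.filter_subset _ _) (Finset.filter_subset _ _) ?_ ?_
    · rw [mul_comm]; exact hx1
    · rw [mul_comm]; exact hx2
  · intro x _ p hp
    rw [walksBetween, Finset.mem_filter, Finset.mem_filter, Finset.mem_filter] at hp
    obtain ⟨-, ⟨-, hp0⟩, ⟨-, hpl⟩, hp⟩ := hp
    rw [Finset.mem_filter]
    refine ⟨Finset.mem_univ _, adj_of_cycleGraph_adj _ (fun i => ?_) ?_⟩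
    · induction i using Fin.cases with
      | zero => exact hp0
      | succ i =>
        rw [← Fin.succ_castSucc, Fin.cons_succ, Fin.cons_succ]
        exact hp i
    · rw [← Fin.succ_last, Fin.cons_succ, Fin.cons_zero]
      exact hpl.symm

end RegularCounting

/-! ### Upper bound via the regularity lemma -/

open SzemerediRegularity

/-- There are at most |X| parts, so rounding the average part size down loses at most a factor 2. -/
lemma div_two_mul_bound_le_card_part {X : Type*} [Fintype X] [DecidableEq X]
    {P : Finpartition (Finset.univ : Finset X)} (hP : P.IsEquipartition) {b : ℕ}
    (hb : P.parts.card ≤ b) {s : Finset X} (hs : s ∈ P.parts) :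
    Fintype.card X / (2 * b : ℝ) ≤ s.card := by
  have hpos : 0 < P.parts.card := Finset.card_pos.2 ⟨s, hs⟩
  have hpos' : (0 : ℝ) < P.parts.card := by exact_mod_cast hpos
  have hcard : P.parts.card ≤ Fintype.card X := by
    rw [← Finset.card_univ]
    exact P.card_parts_le_card
  have hdiv : Fintype.card X ≤ 2 * P.parts.card * (Fintype.card X / P.parts.card) := by
    have h1 := Nat.div_add_mod (Fintype.card X) P.parts.card
    have h2 := Nat.mod_lt (Fintype.card X) hpos
    have h3 : P.parts.card * 1 ≤ P.parts.card * (Fintype.card X / P.parts.card) :=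
      Nat.mul_le_mul_left _ ((Nat.one_le_div_iff hpos).2 hcard)
    rw [mul_assoc]
    omega
  have havg := hP.average_le_card_part hs
  rw [Finset.card_univ] at havg
  calc (Fintype.card X : ℝ) / (2 * b) ≤ Fintype.card X / (2 * P.parts.card) := by gcongr
    _ ≤ ((Fintype.card X / P.parts.card : ℕ) : ℝ) :=
      (div_le_iff₀' (by positivity)).2 (by exact_mod_cast hdiv)
    _ ≤ s.card := by exact_mod_cast havg

open Classical in
/-- Few members of an edge-disjoint family lose an edge when passing to a subgraph `R` of its
union. -/
lemma card_sub_le_card_edges_sub {V X : Type*} [Fintype X] {F : SimpleGraph V}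
    {P : Finset (⊤ : SimpleGraph X).Subgraph} (hP : IsEdgeDisjointCopies F P) {R : SimpleGraph X}
    (hR : R ≤ unionGraph P) :
    (P.card : ℝ) - (P.filter fun A => ∀ x y, A.Adj x y → R.Adj x y).card ≤
      (unionGraph P).edgeFinset.card - R.edgeFinset.card := by
  have hcard : (P.filter fun A => ¬ ∀ x y, A.Adj x y → R.Adj x y).card ≤
      ((unionGraph P).edgeFinset \ R.edgeFinset).card := by
    -- Each damaged member owns a lost edge, and no edge has two owners.
    refine Finset.card_le_card_of_forall_subsingleton (fun A e => e ∈ A.edgeSet) ?_ ?_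
    · intro A hA
      rw [Finset.mem_filter] at hA
      obtain ⟨hA, h⟩ := hA
      push Not at h
      obtain ⟨x, y, h1, h2⟩ := h
      refine ⟨s(x, y), ?_, h1⟩
      rw [Finset.mem_sdiff, mem_edgeFinset, mem_edgeFinset]
      exact ⟨⟨A, hA, h1⟩, h2⟩
    · rintro e - A ⟨hA, hAe⟩ B ⟨hB, hBe⟩
      by_contra hne
      exact Set.disjoint_left.1
        (hP.2 A (Finset.mem_filter.1 hA).1 B (Finset.mem_filter.1 hB).1 hne) hAe hBe
  have h1 := Finset.card_filter_add_card_filter_not (s := P)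
    (fun A => ∀ x y, A.Adj x y → R.Adj x y)
  have h2 : ((unionGraph P).edgeFinset \ R.edgeFinset).card + R.edgeFinset.card =
      (unionGraph P).edgeFinset.card :=
    Finset.card_sdiff_add_card_eq_card (edgeFinset_mono hR)
  have h1' : ((P.filter fun A => ∀ x y, A.Adj x y → R.Adj x y).card : ℝ) +
      (P.filter fun A => ¬ ∀ x y, A.Adj x y → R.Adj x y).card = P.card := by exact_mod_cast h1
  have h2' : (((unionGraph P).edgeFinset \ R.edgeFinset).card : ℝ) + R.edgeFinset.card =
      (unionGraph P).edgeFinset.card := by exact_mod_cast h2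
  have h3 : ((P.filter fun A => ¬ ∀ x y, A.Adj x y → R.Adj x y).card : ℝ) ≤
      ((unionGraph P).edgeFinset \ R.edgeFinset).card := by exact_mod_cast hcard
  linarith

-- The parts containing the images of `f` form a cyclic sequence of regular pairs of density at
-- least ε/4 = 2(ε/8), made periodic over ℕ by the cast to `Fin (m + 3)`.
open Fin.NatCast in
lemma le_card_hom_of_hom_regularityReduced {X : Type*} [Fintype X] [DecidableEq X] {m b : ℕ} {ε : ℝ}
    (hε1 : ε ≤ 1) {H : SimpleGraph X} [DecidableRel H.Adj] {P : Finpartition (Finset.univ : Finset X)}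
    (hP : P.IsEquipartition) (hb : P.parts.card ≤ b) (hb0 : 0 < b) [Nonempty X]
    (f : cycleGraph (m + 3) →g H.regularityReduced P (ε / 8) (ε / 4)) :
    ((ε / 8) ^ 2 / (2 * b)) ^ m * ((ε / 8) ^ 3 / (2 * b) ^ 2) / (4 * b) * Fintype.card X *
        (Fintype.card X : ℝ) ^ (m + 2) ≤
      (Finset.univ.filter fun x : Fin (m + 3) → X =>
        ∀ u v, (cycleGraph (m + 3)).Adj u v → H.Adj (x u) (x v)).card := by
  have hpos : (0 : ℝ) < Fintype.card X / (2 * b : ℝ) := by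
    have : 0 < Fintype.card X := Fintype.card_pos
    positivity
  have hreg : ∀ i : Fin (m + 3), IsRegularDense H (ε / 8) (P.part (f i)) (P.part (f (i + 1))) := by
    intro i
    have h : (H.regularityReduced P (ε / 8) (ε / 4)).Adj (f i) (f (i + 1)) :=
      adj_succ_of_cycleGraph_hom (x := f) (fun u v h => f.map_adj h) i
    obtain ⟨-, U, hU, V, hV, hiU, hiV, -, hunif, hdens⟩ := h
    rw [P.part_eq_of_mem hU hiU, P.part_eq_of_mem hV hiV]
    exact ⟨hunif, by linarith⟩
  have hcount := le_card_cycleGraph_hom (G := H) (ε := ε / 8) (by linarith) hpos m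
    (fun i => P.part (f (i : Fin (m + 3)))) (fun i => by
      have := hreg (i : Fin (m + 3))
      rwa [← Nat.cast_succ] at this)
    (fun i => div_two_mul_bound_le_card_part hP hb (P.part_mem.2 (Finset.mem_univ _)))
    (by simp)
  refine le_trans (le_of_eq ?_) hcount
  rw [show (ε / 8) ^ 2 * (Fintype.card X / (2 * b : ℝ)) =
    (ε / 8) ^ 2 / (2 * b) * Fintype.card X by ring, mul_pow]
  ring

/-- The upper bound for the multicolor Turán number. -/
lemma eventually_card_le {m t : ℕ} (hm : Even m) (ht : 1 ≤ t) {ε : ℝ} (hε : 0 < ε)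
    (hε1 : ε ≤ 1) : ∃ n₀ : ℕ, ∀ n ≥ n₀, ∀ P : Finset (⊤ : SimpleGraph (Fin n)).Subgraph,
      IsEdgeDisjointCopies (blowUp (cycleGraph (m + 5)) t) P →
      ¬ HasRainbowCopy (cycleGraph (m + 3)) P →
      (P.card : ℝ) ≤ (n : ℝ) ^ 2 / (((m + 5 : ℕ) : ℝ) * t) ^ 2 + ε * (n : ℝ) ^ 2 := by
  classical
  set L := ⌈4 / ε⌉₊ with hL
  set b := bound (ε / 8) L with hbdef
  have hb0 : 0 < b := bound_pos _ _
  have hb0' : (0 : ℝ) < b := by exact_mod_cast hb0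
  set K : ℕ := (m + 2 + 1) ^ 3 * ((m + 5) * t + 1) with hK
  set c : ℝ := ((ε / 8) ^ 2 / (2 * b)) ^ m * ((ε / 8) ^ 3 / (2 * b) ^ 2) / (4 * b) with hc
  have hcpos : 0 < c := by positivity
  -- For n > K/c the lower count c n^(m+3) exceeds the upper count K n^(m+2).
  refine ⟨max (L + 1) (⌈K / c⌉₊ + 1), fun n hn P hP hrain => ?_⟩
  have hnL : L + 1 ≤ n := (le_max_left _ _).trans hn
  have hnK : ⌈K / c⌉₊ + 1 ≤ n := (le_max_right _ _).trans hn
  have hn0 : 0 < n := by omega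
  have hn0' : (0 : ℝ) < n := by exact_mod_cast hn0
  have : Nonempty (Fin n) := ⟨⟨0, hn0⟩⟩
  set H := unionGraph P with hH
  obtain ⟨p, hp1, hp2, hp3, hp4⟩ := szemeredi_regularity H (ε := ε / 8) (l := L) (by positivity)
    (by rw [Fintype.card_fin]; omega)
  have hp2' : 4 / ε ≤ p.parts.card := (Nat.le_ceil _).trans (by exact_mod_cast hp2)
  -- Reduction removes at most εn² edges; this needs at least 4/ε parts, whence `L`.
  have hlost := regularityReduced_edges_card_aux hε hp1 hp4 hp2'
  set R := H.regularityReduced p (ε / 8) (ε / 4) with hR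
  set Q := P.filter fun A => ∀ x y, A.Adj x y → R.Adj x y with hQ
  have hQsub : Q ⊆ P := Finset.filter_subset _ _
  have hQcopies : IsEdgeDisjointCopies (blowUp (cycleGraph (m + 5)) t) Q :=
    ⟨fun A hA => hP.1 A (hQsub hA), fun A hA B hB => hP.2 A (hQsub hA) B (hQsub hB)⟩
  have hcardPQ : (P.card : ℝ) - Q.card ≤ H.edgeFinset.card - R.edgeFinset.card := by
    convert card_sub_le_card_edges_sub hP (R := R) regularityReduced_le
  have hempty : IsEmpty (cycleGraph (m + 3) →g unionGraph Q) := by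
    refine ⟨fun f => ?_⟩
    have hle : unionGraph Q ≤ R := by
      rintro x y ⟨A, hA, h⟩
      exact (Finset.mem_filter.1 hA).2 x y h
    have hlow := le_card_hom_of_hom_regularityReduced (H := H) (P := p) (b := b) hε1 hp1 hp3 hb0
      ((Hom.ofLE hle).comp f)
    have hup := card_hom_le_of_not_hasRainbowCopy (M := m + 2) (K := (m + 5) * t) (P := P)
      (fun A hA => (by
        convert (card_verts_of_iso_blowUp (hP.1 A hA).some).le)) hrain
    have hup' : ((Finset.univ.filter fun x : Fin (m + 3) → Fin n =>
        ∀ u v, (cycleGraph (m + 3)).Adj u v → H.Adj (x u) (x v)).card : ℝ) ≤ K * n ^ (m + 2) := by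
      rw [Fintype.card_fin, ← mul_assoc, ← hK] at hup
      have h : (Finset.univ.filter fun x : Fin (m + 3) → Fin n =>
          ∀ u v, (cycleGraph (m + 3)).Adj u v → H.Adj (x u) (x v)).card ≤ K * n ^ (m + 2) := by
        convert hup
      exact_mod_cast h
    rw [Fintype.card_fin] at hlow
    have hcn : c * n * (n : ℝ) ^ (m + 2) ≤ K * (n : ℝ) ^ (m + 2) := by
      refine le_trans hlow (le_trans (le_of_eq ?_) hup')
      congr!
    have hcn' : c * n ≤ K := le_of_mul_le_mul_right hcn (by positivity)
    have hKn : K / c < n := by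
      refine (Nat.le_ceil _).trans_lt ?_
      exact_mod_cast (by omega : ⌈K / c⌉₊ < n)
    rw [div_lt_iff₀ hcpos] at hKn
    linarith
  have hQbound := sq_mul_card_le_of_isEmpty_hom hm ht hQcopies hempty
  rw [Fintype.card_fin] at hQbound
  have hQbound' : (Q.card : ℝ) ≤ (n : ℝ) ^ 2 / (((m + 5 : ℕ) : ℝ) * t) ^ 2 := by
    have ht' : (0 : ℝ) < t := by exact_mod_cast ht
    rw [le_div_iff₀ (by positivity), mul_comm]
    exact_mod_cast hQbound
  rw [Fintype.card_fin] at hlost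
  push_cast at hlost
  linarith

end SimpleGraph

theorem mainTheorem1 (k l t : ℕ) (hk : Odd k) (hk5 : 5 ≤ k) (hl : l = k - 2) (ht : 1 ≤ t) :
    (fun n : ℕ =>
      (SimpleGraph.multicolorTuranNumber
          (SimpleGraph.blowUp (SimpleGraph.cycleGraph k) t) (SimpleGraph.cycleGraph l) n : ℝ)
        - (n : ℝ) ^ 2 / ((k : ℝ) * (t : ℝ)) ^ 2)
      =o[atTop] (fun n : ℕ => (n : ℝ) ^ 2) := by
  obtain ⟨m, rfl⟩ := Nat.exists_eq_add_of_le' hk5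
  obtain rfl : l = m + 3 := by omega
  have hm : Even m := by
    rcases Nat.even_or_odd m with h | h
    · exact h
    · exact absurd hk (by simpa [parity_simps] using h)
  have hedge : (SimpleGraph.cycleGraph (m + 3)).edgeSet.Nonempty :=
    ⟨s(0, 1), by
      rw [SimpleGraph.mem_edgeSet, SimpleGraph.cycleGraph_adj]
      right; simp⟩
  rw [isLittleO_iff]
  intro c hc
  obtain ⟨n₀, hn₀⟩ := SimpleGraph.eventually_card_le hm ht (lt_min hc one_pos) (min_le_right c 1)
  filter_upwards [eventually_ge_atTop n₀, eventually_ge_atTop ((m + 5) * t),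
    eventually_ge_atTop ⌈2 / c⌉₊] with n h1 h2 h3
  have hgreat := SimpleGraph.isGreatest_multicolorTuranNumber
    (SimpleGraph.blowUp (SimpleGraph.cycleGraph (m + 5)) t) (SimpleGraph.cycleGraph (m + 3)) hedge n
  have hD0 : 0 < (m + 5) * t := by positivity
  -- Absorbs the rounding error: q² ≥ (n/D - 1)² ≥ (n/D)² - 2n with D = kt, and 2n ≤ cn².
  have hn3 : 2 ≤ c * n := by
    have := (Nat.le_ceil (2 / c)).trans (Nat.cast_le.2 h3)
    rwa [div_le_iff₀' hc] at this
  set q := n / ((m + 5) * t) with hq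
  have hlow : q ^ 2 ≤ SimpleGraph.multicolorTuranNumber
      (SimpleGraph.blowUp (SimpleGraph.cycleGraph (m + 5)) t)
      (SimpleGraph.cycleGraph (m + 3)) n := by
    refine hgreat.2 (SimpleGraph.sq_mem_multicolorSizes hm ht ((Nat.one_le_div_iff hD0).2 h2) ?_)
    calc (m + 5) * (q * t) = (m + 5) * t * q := by ring
      _ ≤ n := Nat.mul_div_le _ _
  obtain ⟨P, hP1, hP2, hP3⟩ := hgreat.1
  have hup := hn₀ n h1 P hP1 hP2
  rw [hP3] at hup
  have hlow' : ((q : ℝ)) ^ 2 ≤ (SimpleGraph.multicolorTuranNumber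
      (SimpleGraph.blowUp (SimpleGraph.cycleGraph (m + 5)) t)
      (SimpleGraph.cycleGraph (m + 3)) n : ℝ) := by exact_mod_cast hlow
  set D : ℝ := ((m + 5 : ℕ) : ℝ) * (t : ℝ) with hD
  have hD1 : 1 ≤ D := by
    have : 1 ≤ (m + 5) * t := hD0
    rw [hD]
    exact_mod_cast this
  have hn0 : (0 : ℝ) ≤ n := by positivity
  have hx1 : 1 ≤ (n : ℝ) / D := by
    rw [one_le_div (by linarith), hD]
    exact_mod_cast h2
  have hxq : (n : ℝ) / D ≤ q + 1 := by
    rw [div_le_iff₀ (by linarith), hD]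
    have : n ≤ (q + 1) * ((m + 5) * t) := by
      have := Nat.lt_div_mul_add (a := n) hD0
      rw [← hq] at this
      rw [add_mul, one_mul]
      exact this.le
    exact_mod_cast this
  have hxn : (n : ℝ) / D ≤ n := div_le_self hn0 hD1
  have hsq : (n : ℝ) ^ 2 / D ^ 2 = ((n : ℝ) / D) ^ 2 := by rw [div_pow]
  rw [Real.norm_eq_abs, Real.norm_of_nonneg (by positivity), abs_le]
  rw [hsq] at hup ⊢
  constructor
  · have h4 : ((n : ℝ) / D - 1) ^ 2 ≤ (q : ℝ) ^ 2 := by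
      refine pow_le_pow_left₀ (by linarith) (by linarith) 2
    have h5 : 2 * (n : ℝ) ≤ c * n ^ 2 := by nlinarith
    nlinarith
  · have h6 : min c 1 * (n : ℝ) ^ 2 ≤ c * (n : ℝ) ^ 2 := by
      gcongr
      exact min_le_left _ _
    linarith
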